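/- Let $d\ge 1$ and let $\{Z_{\mathbf n}:\mathbf n\in\mathbb Z^d\}$ be i.i.d. real random variables such that $P(|Z_{\mathbf 0}|>x)=x^{-\alpha}L(x)$ for $x>0$, with $\alpha>0$ and $L$ slowly varying at infinity, and $P(Z_{\mathbf 0}>x)/P(|Z_{\mathbf 0}|>x)\to p$ as $x\to\infty$, with $p\in[0,1]$; put $q:=1-p$. Let $c_{\mathbf j}\in\mathbb R$ ($\mathbf j\in\mathbb Z^d$), not all zero, satisfy $\sum_{\mathbf j}|c_{\mathbf j}|^{\beta}<\infty$ for some $0<\beta<\alpha$. Put $$X_{\mathbf n}:=\sup_{\mathbf j\in\mathbb Z^d}c_{\mathbf j}Z_{\mathbf n+\mathbf j},\qquad c^+:=\max_{\mathbf i}\max\{c_{\mathbf i},0\},\qquad c^-:=\max_{\mathbf i}\max\{-c_{\mathbf i},0\},$$ and $a_n:=\inf\{y>0: P(|Z_{\mathbf 0}|>y)\le n^{-d}\}$. Then almost surely all the suprema $X_{\mathbf n}$, $\mathbf n\in\mathbb Z^d$, are finite, $\sum_{\mathbf j}|c_{\mathbf j}|^\alpha<\infty$, and the following holds for every $v>0$,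 with $v_n:=a_nv$, and every sequence $\mathbf N(n)=(N_1(n),\dots,N_d(n))\in\mathbb N^d$ such that $N_l(n)\to\infty$ for each $l$ and $N_1(n)\cdots N_d(n)\sim n^d$. Let $M_{\mathbf N(n)}:=\max\{X_{\mathbf i}: 1\le i_l\le N_l(n),\ 1\le l\le d\}$. (i) As $n\to\infty$, $$P(M_{\mathbf N(n)}\le v_n)\to\exp\left(-\left(p(c^+)^\alpha+q(c^-)^\alpha\right)v^{-\alpha}\right).$$ (ii) If $p\sum_{c_{\mathbf j}>0}c_{\mathbf j}^\alpha+q\sum_{c_{\mathbf j}<0}|c_{\mathbf j}|^\alpha>0$, then the extremal index, that is, a number $\theta\in[0,1]$ with $P(M_{\mathbf N(n)}\le v_n)-P(X_{\mathbf 0}\le v_n)^{\theta n^d}\to0$ as $n\to\infty$, exists, is unique, and equals $$\theta=\frac{p(c^+)^\alpha+q(c^-)^\alpha}{p\sum_{c_{\mathbf j}>0}c_{\mathbf j}^\alpha+q\sum_{c_{\mathbf j}<0}|c_{\mathbf j}|^\alpha}.$$ -/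

import Mathlib

open MeasureTheory ProbabilityTheory Filter Topology Asymptotics

namespace MovingMaxima

noncomputable section

/-- `L` is slowly varying at infinity: positive and measurable on a neighbourhood of infinity,
with `L (t x) / L x → 1` as `x → ∞`, for every `t > 0`. -/
def SlowlyVarying (L : ℝ → ℝ) : Prop :=
  (∃ x₀ : ℝ, (∀ x, x₀ ≤ x → 0 < L x) ∧ Measurable ((Set.Ici x₀).domRestrict L)) ∧
    ∀ t : ℝ, 0 < t → Tendsto (fun x => L (t * x) / L x) atTop (𝓝 1)

/-- The moving maximum field `X_n = sup_j c_j Z_{n+j}`. (The theorem asserts that almost surely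
all these suprema are over bounded sets.) -/
def movingMax {d : ℕ} {Ω : Type*} (c : (Fin d → ℤ) → ℝ) (Z : (Fin d → ℤ) → Ω → ℝ)
    (n : Fin d → ℤ) (ω : Ω) : ℝ :=
  ⨆ j : Fin d → ℤ, c j * Z (n + j) ω

/-- The partial maximum `M_N = sup {X_i : 1 ≤ i ≤ N}` over the finite box
`{1, …, N_1} × ⋯ × {1, …, N_d}`. -/
def partialMax {d : ℕ} {Ω : Type*} (X : (Fin d → ℤ) → Ω → ℝ) (N : Fin d → ℕ) (ω : Ω) : ℝ :=
  ⨆ i : Set.Icc (1 : Fin d → ℤ) (fun l => (N l : ℤ)), X i ω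

/-- The normalising constant `a_n = inf {y > 0 : P(|Y| > y) ≤ n^{-d}}` of a random variable. -/
def normConst {Ω : Type*} [MeasurableSpace Ω] (P : Measure Ω) (d : ℕ) (Y : Ω → ℝ) (n : ℕ) : ℝ :=
  sInf {y : ℝ | 0 < y ∧ P.real {ω | y < |Y ω|} ≤ ((n : ℝ) ^ d)⁻¹}

/-- `θ ∈ [0,1]` is an extremal index of the field `X` along the boxes `N(n)` and levels `u_n`:
`P(M_{N(n)} ≤ u_n) - P(X_0 ≤ u_n)^{θ n^d} → 0`. -/
def IsExtremalIndex {d : ℕ} {Ω : Type*} [MeasurableSpace Ω] (P : Measure Ω)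
    (X : (Fin d → ℤ) → Ω → ℝ) (N : ℕ → Fin d → ℕ) (u : ℕ → ℝ) (θ : ℝ) : Prop :=
  θ ∈ Set.Icc (0 : ℝ) 1 ∧
    Tendsto (fun n : ℕ => P.real {ω | partialMax X (N n) ω ≤ u n}
      - (P.real {ω | X 0 ω ≤ u n}) ^ (θ * (n : ℝ) ^ d)) atTop (𝓝 0)

/-- `c⁺ = max_i max {c_i, 0}`; the supremum is attained when `c` is summable to some power. -/
def cPlus {d : ℕ} (c : (Fin d → ℤ) → ℝ) : ℝ := ⨆ i, max (c i) 0

/-- `c⁻ = max_i max {-c_i, 0}`. -/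
def cMinus {d : ℕ} (c : (Fin d → ℤ) → ℝ) : ℝ := ⨆ i, max (-c i) 0

end

end MovingMaxima

/-! A large partial maximum comes from one large innovation. Let `u = a_n v`. A fixed `Z_k` with `k`
well inside the box meets every nearby coefficient, so its constraints reduce to the two extreme
ones, `c⁺ Z_k ≤ u` and `-c⁻ Z_k ≤ u`. These fail with probability `q_n`, and `n^d q_n → A v^{-α}`,
where `A = p (c⁺)^α + (1-p) (c⁻)^α`. If coefficients outside a cube of radius `r` are ignored,
independence traps `P(M ≤ u)` between powers of `1 - q_n` whose exponents count the box shrunk or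
enlarged by `r` (`measureReal_partialMax_le`, `le_measureReal_partialMax`); both powers tend to
`exp(-A v^{-α})`. The ignored coefficients cost a union bound, which Potter's inequality makes at
most a constant times `∑_{far} |c_j|^β`, uniformly in large `n`, hence negligible as `r` grows.

For the single variable `X_0` every coefficient multiplies a different innovation, so all of them
count: with `Q_n = ∑_j P(c_j Z_0 > u)`, `P(X_0 ≤ u)` lies between `1 - Q_n` and `exp(-Q_n)`, and
dominated convergence gives `n^d Q_n → B v^{-α}`, `B` being the denominator of `θ`. Comparing
`exp(-A v^{-α})` with `exp(-θ B v^{-α})` forces `θ = A / B`. -/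

namespace MovingMaxima

/-! ### Potter bounds for regularly varying tails -/

/-- A positive nonincreasing function vanishing at infinity, regularly varying with index `-α`. -/
structure RegVarTail (F : ℝ → ℝ) (α : ℝ) : Prop where
  antitone : Antitone F
  pos : ∀ x, 0 < F x
  tendsto_zero : Tendsto F atTop (𝓝 0)
  ratio : ∀ t : ℝ, 0 < t → Tendsto (fun x => F (t * x) / F x) atTop (𝓝 (t ^ (-α)))

/-- Potter's upper bound along powers of two. -/
theorem RegVarTail.le_dyadic {F : ℝ → ℝ} {α β : ℝ} (h : RegVarTail F α) (hβα : β < α) :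
    ∃ x₀ : ℝ, 0 < x₀ ∧ ∀ x, x₀ ≤ x → ∀ m : ℕ,
      F (2 ^ m * x) ≤ ((2 : ℝ) ^ (-β)) ^ m * F x := by
  have hlt : (2 : ℝ) ^ (-α) < 2 ^ (-β) :=
    Real.rpow_lt_rpow_of_exponent_lt (by norm_num) (by linarith)
  obtain ⟨x₀, hx₀⟩ := eventually_atTop.1 ((h.ratio 2 two_pos).eventually_lt_const hlt)
  refine ⟨max x₀ 1, by positivity, fun x hx m => ?_⟩
  have hx1 : 1 ≤ x := (le_max_right _ _).trans hx
  have hx0 : x₀ ≤ x := (le_max_left _ _).trans hx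
  induction m with
  | zero => simp
  | succ m ih =>
    have h2 : x ≤ 2 ^ m * x := le_mul_of_one_le_left (by linarith) (one_le_pow₀ (by norm_num))
    have h3 := (div_lt_iff₀ (h.pos _)).1 (hx₀ _ (hx0.trans h2))
    calc F (2 ^ (m + 1) * x) = F (2 * (2 ^ m * x)) := by ring_nf
      _ ≤ 2 ^ (-β) * F (2 ^ m * x) := h3.le
      _ ≤ 2 ^ (-β) * ((2 ^ (-β)) ^ m * F x) := by gcongr
      _ = _ := by ring

/-- Potter's upper bound for dilations by factors at least one. -/
theorem RegVarTail.le_rpow {F : ℝ → ℝ} {α β : ℝ} (h : RegVarTail F α) (hβ : 0 < β)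
    (hβα : β < α) :
    ∃ x₀ : ℝ, 0 < x₀ ∧ ∀ x, x₀ ≤ x → ∀ t, 1 ≤ t → F (t * x) ≤ 2 ^ β * t ^ (-β) * F x := by
  obtain ⟨x₀, hx₀, hF⟩ := h.le_dyadic hβα
  refine ⟨x₀, hx₀, fun x hx t ht => ?_⟩
  -- Rounding `t` down to a power of two costs at most a factor `2`, whence the constant `2 ^ β`.
  obtain ⟨m, hm1, hm2⟩ := exists_nat_pow_near ht (one_lt_two (α := ℝ))
  have hx0 : 0 < x := hx₀.trans_le hx
  have ht0 : 0 < t := by linarith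
  have hFx := h.pos x
  calc F (t * x) ≤ F (2 ^ m * x) := h.antitone (by gcongr)
    _ ≤ ((2 : ℝ) ^ (-β)) ^ m * F x := hF x hx m
    _ = 2 ^ β * ((2 : ℝ) ^ (m + 1)) ^ (-β) * F x := by
      rw [← Real.rpow_natCast, ← Real.rpow_natCast, ← Real.rpow_mul (by norm_num),
        ← Real.rpow_mul (by norm_num), ← Real.rpow_add (by norm_num)]
      congr 2
      push_cast
      ring
    _ ≤ 2 ^ β * t ^ (-β) * F x := by
      have := Real.rpow_le_rpow_of_nonpos ht0 hm2.le (z := -β) (by linarith)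
      gcongr

/-- Potter's upper bound for scalings by bounded factors. -/
theorem RegVarTail.div_le_rpow {F : ℝ → ℝ} {α β C : ℝ} (h : RegVarTail F α) (hβ : 0 < β)
    (hβα : β < α) (hC : 0 < C) :
    ∃ K : ℝ, 0 ≤ K ∧ ∃ x₀ : ℝ, 0 < x₀ ∧ ∀ x, x₀ ≤ x → ∀ s, 0 < s → s ≤ C →
      F (x / s) ≤ K * s ^ β * F x := by
  obtain ⟨x₁, hx₁, hF⟩ := h.le_rpow hβ hβα
  have hC' : 0 < C⁻¹ := inv_pos.2 hC
  obtain ⟨x₂, hx₂⟩ := eventually_atTop.1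
    ((h.ratio C⁻¹ hC').eventually_lt_const (lt_add_one _))
  set K₁ : ℝ := C⁻¹ ^ (-α) + 1
  have hK₁ : 0 ≤ K₁ := by positivity
  refine ⟨2 ^ β * C⁻¹ ^ β * K₁, by positivity, max (C * x₁) x₂,
    lt_max_of_lt_left (by positivity), fun x hx s hs hsC => ?_⟩
  have hxC : x₁ ≤ C⁻¹ * x := by
    rw [inv_mul_eq_div, le_div_iff₀ hC, mul_comm]
    exact (le_max_left _ _).trans hx
  have h1 : 1 ≤ C / s := (one_le_div hs).2 hsC
  have h3 := ((div_lt_iff₀ (h.pos _)).1 (hx₂ x ((le_max_right _ _).trans hx))).le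
  -- Rebasing at `C⁻¹ * x` makes the dilation factor `C / s` at least one; the ratio limit at `C⁻¹`
  -- then returns to `F x`.
  calc F (x / s) = F (C / s * (C⁻¹ * x)) := by congr 1; field_simp
    _ ≤ 2 ^ β * (C / s) ^ (-β) * F (C⁻¹ * x) := hF _ hxC _ h1
    _ ≤ 2 ^ β * (C / s) ^ (-β) * (K₁ * F x) := by gcongr
    _ = 2 ^ β * (C⁻¹ ^ β * s ^ β) * (K₁ * F x) := by
      rw [Real.rpow_neg (by positivity), ← Real.inv_rpow (by positivity), inv_div,
        div_eq_inv_mul, Real.mul_rpow hC'.le hs.le]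
    _ = _ := by ring

/-! ### Normalising constants -/

/-- The sequence of quantile-type normalising constants of a tail function. -/
noncomputable def tailQuantile (F : ℝ → ℝ) (d n : ℕ) : ℝ :=
  sInf {y : ℝ | 0 < y ∧ F y ≤ ((n : ℝ) ^ d)⁻¹}

theorem tailQuantile_nonneg (F : ℝ → ℝ) (d n : ℕ) : 0 ≤ tailQuantile F d n :=
  Real.sInf_nonneg fun _ hy => hy.1.le

theorem tendsto_natCast_pow_atTop {d : ℕ} (hd : 1 ≤ d) :
    Tendsto (fun n : ℕ => (n : ℝ) ^ d) atTop atTop :=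
  (tendsto_pow_atTop (by omega)).comp tendsto_natCast_atTop_atTop

theorem RegVarTail.exists_mem {F : ℝ → ℝ} {α : ℝ} (h : RegVarTail F α) {d n : ℕ} (hn : 0 < n) :
    {y : ℝ | 0 < y ∧ F y ≤ ((n : ℝ) ^ d)⁻¹}.Nonempty := by
  have : (0 : ℝ) < ((n : ℝ) ^ d)⁻¹ := by positivity
  exact ((eventually_gt_atTop 0).and
    ((h.tendsto_zero.eventually_lt_const this).mono fun _ => le_of_lt)).exists

theorem RegVarTail.tendsto_tailQuantile {F : ℝ → ℝ} {α : ℝ} (h : RegVarTail F α) {d : ℕ}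
    (hd : 1 ≤ d) : Tendsto (tailQuantile F d) atTop atTop := by
  refine tendsto_atTop.2 fun y => ?_
  have h0 : Tendsto (fun n : ℕ => ((n : ℝ) ^ d)⁻¹) atTop (𝓝 0) :=
    (tendsto_natCast_pow_atTop hd).inv_tendsto_atTop
  filter_upwards [h0.eventually_lt_const (h.pos y), eventually_gt_atTop 0] with n hn hn0
  refine le_csInf (h.exists_mem hn0) fun z hz => ?_
  by_contra! hzy
  exact (hz.2.trans_lt hn).not_ge (h.antitone hzy.le)

theorem RegVarTail.pow_mul_le_one {F : ℝ → ℝ} {α : ℝ} (h : RegVarTail F α) {d n : ℕ}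
    (hn : 0 < n) {x : ℝ} (hx : tailQuantile F d n < x) : (n : ℝ) ^ d * F x ≤ 1 := by
  obtain ⟨y, hy, hyx⟩ := exists_lt_of_csInf_lt (h.exists_mem hn) hx
  have hn' : (0 : ℝ) < (n : ℝ) ^ d := by positivity
  calc (n : ℝ) ^ d * F x ≤ (n : ℝ) ^ d * ((n : ℝ) ^ d)⁻¹ := by
        gcongr
        exact (h.antitone hyx.le).trans hy.2
    _ = 1 := mul_inv_cancel₀ hn'.ne'

theorem one_lt_pow_mul {F : ℝ → ℝ} {d n : ℕ} (hn : 0 < n) {x : ℝ} (hx0 : 0 < x)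
    (hx : x < tailQuantile F d n) : 1 < (n : ℝ) ^ d * F x := by
  have hn' : (0 : ℝ) < (n : ℝ) ^ d := by positivity
  by_contra! hle
  refine notMem_of_lt_csInf hx ⟨0, fun y hy => hy.1.le⟩ ⟨hx0, ?_⟩
  rwa [← one_div, le_div_iff₀' hn']

/-- `F` may jump at the quantile `a`, so the product need not equal `1`. But `n^d F(t a)` exceeds
`1` for `t < 1` and is at most `1` for `t > 1`, while `F(a) / F(t a) → t^α`, which is close to `1`
for `t` near `1`. -/
theorem RegVarTail.tendsto_pow_mul_self {F : ℝ → ℝ} {α : ℝ} (h : RegVarTail F α) {d : ℕ}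
    (hd : 1 ≤ d) :
    Tendsto (fun n : ℕ => (n : ℝ) ^ d * F (tailQuantile F d n)) atTop (𝓝 1) := by
  have ha := h.tendsto_tailQuantile hd
  have key : ∀ t : ℝ, 0 < t → Tendsto
      (fun n : ℕ => F (tailQuantile F d n) / F (t * tailQuantile F d n)) atTop (𝓝 (t ^ α)) := by
    intro t ht
    have := ((h.ratio t ht).comp ha).inv₀ (Real.rpow_pos_of_pos ht _).ne'
    rw [← Real.rpow_neg ht.le, neg_neg] at this
    simpa [Function.comp_def] using this
  have hcont : Tendsto (fun t : ℝ => t ^ α) (𝓝 1) (𝓝 1) := by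
    have := Real.continuousAt_rpow_const 1 α (Or.inl one_ne_zero)
    simpa [ContinuousAt] using this
  have hrep : ∀ (t : ℝ) (n : ℕ), (n : ℝ) ^ d * F (tailQuantile F d n)
      = (n : ℝ) ^ d * F (t * tailQuantile F d n) *
        (F (tailQuantile F d n) / F (t * tailQuantile F d n)) := fun t n => by
    have := (h.pos (t * tailQuantile F d n)).ne'
    field_simp
  have hnn : ∀ t n, 0 ≤ F (tailQuantile F d n) / F (t * tailQuantile F d n) :=
    fun t n => (div_pos (h.pos _) (h.pos _)).le
  refine tendsto_order.2 ⟨fun b hb => ?_, fun b hb => ?_⟩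
  · obtain ⟨t, ht, htb⟩ := ((eventually_mem_nhdsWithin (s := Set.Iio (1 : ℝ))).and
      (((hcont.eventually_const_lt hb).and
        (eventually_gt_nhds one_pos)).filter_mono nhdsWithin_le_nhds)).exists
    filter_upwards [(key t htb.2).eventually_const_lt htb.1, eventually_gt_atTop 0,
      ha.eventually_gt_atTop 0] with n h1 h2 h3
    rw [hrep t n]
    have := one_lt_pow_mul (F := F) h2 (mul_pos htb.2 h3) (mul_lt_of_lt_one_left h3 ht)
    exact h1.trans_le (le_mul_of_one_le_left (hnn _ _) this.le)
  · obtain ⟨t, ht, htb⟩ := ((eventually_mem_nhdsWithin (s := Set.Ioi (1 : ℝ))).and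
      (((hcont.eventually_lt_const hb).and
        (eventually_gt_nhds one_pos)).filter_mono nhdsWithin_le_nhds)).exists
    filter_upwards [(key t htb.2).eventually_lt_const htb.1, eventually_gt_atTop 0,
      ha.eventually_gt_atTop 0] with n h1 h2 h3
    rw [hrep t n]
    have := h.pow_mul_le_one (d := d) h2 (lt_mul_of_one_lt_left h3 ht)
    exact (mul_le_of_le_one_left (hnn _ _) this).trans_lt h1

/-- `n^d F(a_n t) → t^{-α}`. -/
theorem RegVarTail.tendsto_pow_mul {F : ℝ → ℝ} {α : ℝ} (h : RegVarTail F α) {d : ℕ}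
    (hd : 1 ≤ d) {t : ℝ} (ht : 0 < t) :
    Tendsto (fun n : ℕ => (n : ℝ) ^ d * F (tailQuantile F d n * t)) atTop (𝓝 (t ^ (-α))) := by
  have := (h.tendsto_pow_mul_self hd).mul ((h.ratio t ht).comp (h.tendsto_tailQuantile hd))
  rw [one_mul] at this
  refine this.congr fun n => ?_
  have := (h.pos (tailQuantile F d n)).ne'
  simp only [Function.comp_apply]
  rw [mul_comm t]
  field_simp

/-! ### Exponential limits of powers -/

/-- The Poisson limit for powers of `b n ≈ 1 - q n`. -/
theorem tendsto_rpow_exp_neg {q b m : ℕ → ℝ} {s : ℝ} (hm : ∀ n, 0 ≤ m n)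
    (hq : Tendsto q atTop (𝓝 0)) (hmq : Tendsto (fun n => m n * q n) atTop (𝓝 s))
    (hlo : ∀ᶠ n in atTop, 1 - q n ≤ b n) (hhi : ∀ᶠ n in atTop, b n ≤ Real.exp (-q n)) :
    Tendsto (fun n => b n ^ m n) atTop (𝓝 (Real.exp (-s))) := by
  have hev : ∀ᶠ n in atTop, q n < 1 := hq.eventually_lt_const one_pos
  have h1 : Tendsto (fun n => Real.exp (-(m n * q n))) atTop (𝓝 (Real.exp (-s))) :=
    (Real.continuous_exp.tendsto _).comp hmq.neg
  have h2 : Tendsto (fun n => Real.exp (-(m n * q n / (1 - q n)))) atTop (𝓝 (Real.exp (-s))) := by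
    have : Tendsto (fun n => m n * q n / (1 - q n)) atTop (𝓝 (s / (1 - 0))) :=
      hmq.div (tendsto_const_nhds.sub hq) (by norm_num)
    rw [sub_zero, div_one] at this
    exact (Real.continuous_exp.tendsto _).comp this.neg
  refine tendsto_of_tendsto_of_tendsto_of_le_of_le' h2 h1 ?_ ?_
  · filter_upwards [hev, hlo] with n hn hb
    have hpos : 0 < 1 - q n := by linarith
    have hlog : -(q n / (1 - q n)) ≤ Real.log (1 - q n) := by
      have := Real.one_sub_inv_le_log_of_pos hpos
      convert! this using 1
      field_simp
      ring
    calc Real.exp (-(m n * q n / (1 - q n))) = Real.exp (-(q n / (1 - q n)) * m n) := by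
          congr 1; ring
      _ ≤ Real.exp (Real.log (1 - q n) * m n) := by
          have := hm n
          gcongr
      _ = (1 - q n) ^ m n := (Real.rpow_def_of_pos hpos _).symm
      _ ≤ b n ^ m n := Real.rpow_le_rpow hpos.le hb (hm n)
  · filter_upwards [hev, hlo, hhi] with n hn hb hb'
    calc b n ^ m n ≤ Real.exp (-q n) ^ m n := Real.rpow_le_rpow (by linarith) hb' (hm n)
      _ = Real.exp (-(m n * q n)) := by rw [← Real.exp_mul]; congr 1; ring

/-- Changing every side by a fixed amount does not affect the volume asymptotically; applied with `k
= ± 2 r`. The truncation in `toNat` is eventually inactive. -/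
theorem tendsto_prod_toNat_div {d : ℕ} {N : ℕ → Fin d → ℕ}
    (hN : ∀ l, Tendsto (fun n => N n l) atTop atTop)
    (hNd : (fun n : ℕ => ∏ l, (N n l : ℝ)) ~[atTop] fun n : ℕ => (n : ℝ) ^ d) (k : ℤ) :
    Tendsto (fun n : ℕ => (∏ l, (((N n l : ℤ) + k).toNat : ℝ)) / (n : ℝ) ^ d) atTop (𝓝 1) := by
  have h1 : Tendsto (fun n : ℕ => (∏ l, (N n l : ℝ)) / (n : ℝ) ^ d) atTop (𝓝 1) :=
    (isEquivalent_iff_tendsto_one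
      ((eventually_gt_atTop 0).mono fun n hn => by positivity)).1 hNd
  have hR : ∀ l, Tendsto (fun n => (N n l : ℝ)) atTop atTop :=
    fun l => tendsto_natCast_atTop_atTop.comp (hN l)
  have h2 : Tendsto (fun n : ℕ => ∏ l, (1 + (k : ℝ) / (N n l : ℝ))) atTop (𝓝 1) := by
    have : Tendsto (fun n : ℕ => ∏ l, (1 + (k : ℝ) / (N n l : ℝ))) atTop
        (𝓝 (∏ _l : Fin d, (1 + 0))) :=
      tendsto_finsetProd _ fun l _ => tendsto_const_nhds.add (tendsto_const_nhds.div_atTop (hR l))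
    simpa using this
  have h3 := h2.mul h1
  rw [one_mul] at h3
  refine h3.congr' ?_
  have hev : ∀ᶠ n in atTop, ∀ l, k.natAbs + 1 ≤ N n l :=
    eventually_all.2 fun l => (hN l).eventually_ge_atTop _
  filter_upwards [hev] with n hn
  rw [← mul_div_assoc, ← Finset.prod_mul_distrib]
  congr 1
  refine Finset.prod_congr rfl fun l _ => ?_
  have hl := hn l
  have hz : (((N n l : ℤ) + k).toNat : ℤ) = N n l + k := Int.toNat_of_nonneg (by omega)
  have hz' : (((N n l : ℤ) + k).toNat : ℝ) = N n l + k := by exact_mod_cast hz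
  have : (N n l : ℝ) ≠ 0 := by
    have : N n l ≠ 0 := by omega
    exact_mod_cast this
  rw [hz']
  field_simp

theorem tendsto_zero_of_pow_mul {d : ℕ} (hd : 1 ≤ d) {q : ℕ → ℝ} {s : ℝ}
    (hq : Tendsto (fun n : ℕ => (n : ℝ) ^ d * q n) atTop (𝓝 s)) : Tendsto q atTop (𝓝 0) := by
  have := hq.mul (tendsto_natCast_pow_atTop hd).inv_tendsto_atTop
  rw [mul_zero] at this
  refine this.congr' ?_
  filter_upwards [eventually_gt_atTop 0] with n hn
  have : (n : ℝ) ^ d ≠ 0 := by positivity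
  simp only [Pi.inv_apply]
  field_simp

theorem tendsto_one_sub_pow_prod_toNat {d : ℕ} (hd : 1 ≤ d) {N : ℕ → Fin d → ℕ}
    (hN : ∀ l, Tendsto (fun n => N n l) atTop atTop)
    (hNd : (fun n : ℕ => ∏ l, (N n l : ℝ)) ~[atTop] fun n : ℕ => (n : ℝ) ^ d) (k : ℤ)
    {q : ℕ → ℝ} {s : ℝ} (hq : Tendsto (fun n : ℕ => (n : ℝ) ^ d * q n) atTop (𝓝 s)) :
    Tendsto (fun n => (1 - q n) ^ (∏ l, ((N n l : ℤ) + k).toNat)) atTop (𝓝 (Real.exp (-s))) := by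
  have hq0 := tendsto_zero_of_pow_mul hd hq
  have hmq : Tendsto (fun n => (∏ l, (((N n l : ℤ) + k).toNat : ℝ)) * q n) atTop (𝓝 s) := by
    have := (tendsto_prod_toNat_div hN hNd k).mul hq
    rw [one_mul] at this
    refine this.congr' ?_
    filter_upwards [eventually_gt_atTop 0] with n hn
    have : (n : ℝ) ^ d ≠ 0 := by positivity
    field_simp
  have := tendsto_rpow_exp_neg (b := fun n => 1 - q n)
    (fun n => Finset.prod_nonneg fun l _ => Nat.cast_nonneg _) hq0 hmq
    (Eventually.of_forall fun n => le_rfl)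
    (Eventually.of_forall fun n => Real.one_sub_le_exp_neg _)
  refine this.congr fun n => ?_
  rw [← Nat.cast_prod, Real.rpow_natCast]

/-! ### Tails of one scaled innovation -/

section Tails

variable {Ω : Type*} [MeasurableSpace Ω] {P : Measure Ω} {Y : Ω → ℝ}

theorem measureReal_iUnion_le_tsum [IsProbabilityMeasure P] {ι : Type*} [Countable ι]
    (s : ι → Set Ω)
    (h : Summable fun i => P.real (s i)) : P.real (⋃ i, s i) ≤ ∑' i, P.real (s i) := by
  refine ENNReal.toReal_le_of_le_ofReal (tsum_nonneg fun _ => measureReal_nonneg) ?_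
  rw [ENNReal.ofReal_tsum_of_nonneg (fun _ => measureReal_nonneg) h]
  simpa using measure_iUnion_le (μ := P) s

theorem tendsto_measureReal_lt_atTop [IsProbabilityMeasure P] (hY : Measurable Y) :
    Tendsto (fun x => P.real {ω | x < Y ω}) atTop (𝓝 0) := by
  have := Measure.isProbabilityMeasure_map (μ := P) hY.aemeasurable
  have h := (tendsto_cdf_atTop (P.map Y)).const_sub 1
  rw [sub_self] at h
  refine h.congr fun x => ?_
  rw [cdf_eq_real, ← probReal_compl_eq_one_sub measurableSet_Iic, Set.compl_Iic,
    map_measureReal_apply hY measurableSet_Ioi]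
  rfl

theorem regVarTail_abs [IsProbabilityMeasure P] (hY : Measurable Y) {α : ℝ} {L : ℝ → ℝ}
    (hL : SlowlyVarying L)
    (hreg : ∀ x : ℝ, 0 < x → P.real {ω | x < |Y ω|} = x ^ (-α) * L x) :
    RegVarTail (fun x => P.real {ω | x < |Y ω|}) α := by
  have hanti : Antitone fun x => P.real {ω | x < |Y ω|} := fun x y hxy =>
    measureReal_mono fun ω hω => lt_of_le_of_lt hxy hω
  obtain ⟨⟨x₀, hx₀, -⟩, hratio⟩ := hL
  refine ⟨hanti, fun x => ?_, tendsto_measureReal_lt_atTop hY.abs, fun t ht => ?_⟩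
  -- `L` is known to be positive only beyond `x₀`; monotonicity carries positivity of the tail back
  -- to smaller `x`.
  · set y := max (max x x₀) 1
    have hy : 0 < y := lt_max_of_lt_right one_pos
    refine lt_of_lt_of_le ?_ (hanti ((le_max_left _ _).trans (le_max_left _ _) : x ≤ y))
    simp only [hreg y hy]
    exact mul_pos (Real.rpow_pos_of_pos hy _)
      (hx₀ _ ((le_max_right _ _).trans (le_max_left _ _)))
  · have := (hratio t ht).const_mul (t ^ (-α))
    rw [mul_one] at this
    refine this.congr' ?_
    filter_upwards [eventually_gt_atTop 0] with x hx
    rw [hreg x hx, hreg (t * x) (by positivity), Real.mul_rpow ht.le hx.le]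
    have : x ^ (-α) ≠ 0 := (Real.rpow_pos_of_pos hx _).ne'
    field_simp

/-- The weight `p s₊^α + (1 - p) s₋^α`. -/
noncomputable def tailWeight (p α s : ℝ) : ℝ := p * max s 0 ^ α + (1 - p) * max (-s) 0 ^ α

theorem tendsto_pow_mul_measureReal_of_pos {α p s v : ℝ} {d : ℕ}
    (hF : RegVarTail (fun x => P.real {ω | x < |Y ω|}) α) (hd : 1 ≤ d)
    (hbal : Tendsto (fun x : ℝ => P.real {ω | x < Y ω} / P.real {ω | x < |Y ω|}) atTop (𝓝 p))
    (hs : 0 < s) (hv : 0 < v) :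
    Tendsto (fun n : ℕ => (n : ℝ) ^ d * P.real {ω | normConst P d Y n * v < s * Y ω}) atTop
      (𝓝 (p * s ^ α * v ^ (-α))) := by
  have hvs : 0 < v / s := by positivity
  have ha : Tendsto (fun n => normConst P d Y n * (v / s)) atTop atTop :=
    (hF.tendsto_tailQuantile hd).atTop_mul_const hvs
  have h1 := (hF.tendsto_pow_mul hd hvs).mul (hbal.comp ha)
  have hlim : (v / s) ^ (-α) * p = p * s ^ α * v ^ (-α) := by
    rw [Real.div_rpow hv.le hs.le, Real.rpow_neg hs.le, div_inv_eq_mul]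
    ring
  rw [hlim] at h1
  refine h1.congr fun n => ?_
  have hset : {ω | normConst P d Y n * v < s * Y ω}
      = {ω | normConst P d Y n * (v / s) < Y ω} := by
    ext ω
    simp only [Set.mem_ofPred_eq]
    rw [← mul_div_assoc, div_lt_iff₀ hs, mul_comm (Y ω)]
  have hne := (hF.pos (normConst P d Y n * (v / s))).ne'
  have hq : tailQuantile (fun x => P.real {ω | x < |Y ω|}) d n = normConst P d Y n := rfl
  rw [hset, hq]
  simp only [Function.comp_apply]
  generalize P.real {ω | normConst P d Y n * (v / s) < |Y ω|} = x at hne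
  field_simp

/-- `n^d P(sY > a_n v)` converges to `(p s₊^α + (1 - p) s₋^α) v^{-α}`. -/
theorem tendsto_pow_mul_measureReal [IsProbabilityMeasure P] (hY : Measurable Y)
    {α p v : ℝ} {d : ℕ} (hα : 0 < α)
    (hF : RegVarTail (fun x => P.real {ω | x < |Y ω|}) α) (hd : 1 ≤ d)
    (hbal : Tendsto (fun x : ℝ => P.real {ω | x < Y ω} / P.real {ω | x < |Y ω|}) atTop (𝓝 p))
    (s : ℝ) (hv : 0 < v) :
    Tendsto (fun n : ℕ => (n : ℝ) ^ d * P.real {ω | normConst P d Y n * v < s * Y ω}) atTop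
      (𝓝 (tailWeight p α s * v ^ (-α))) := by
  have h0 : (0 : ℝ) ^ α = 0 := Real.zero_rpow hα.ne'
  rcases lt_trichotomy s 0 with hs | rfl | hs
  -- A negative coefficient is a positive one acting on `-Y`, whose balance constant is `1 - p`.
  · have hbal' : Tendsto (fun x : ℝ => P.real {ω | x < -Y ω} / P.real {ω | x < |(-Y ω)|}) atTop
        (𝓝 (1 - p)) := by
      refine (hbal.const_sub 1).congr' ?_
      filter_upwards [eventually_ge_atTop 0] with x hx
      have hset : {ω | x < |Y ω|} = {ω | x < Y ω} ∪ {ω | x < -Y ω} := by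
        ext ω
        exact lt_abs (a := x) (b := Y ω)
      have hdisj : Disjoint {ω | x < Y ω} {ω | x < -Y ω} :=
        Set.disjoint_left.2 fun ω h1 h2 => by
          simp only [Set.mem_ofPred_eq] at h1 h2
          linarith
      have hadd := measureReal_union (μ := P) hdisj (measurableSet_lt measurable_const hY.neg)
      rw [← hset] at hadd
      have hne := (hF.pos x).ne'
      simp only [abs_neg]
      rw [eq_div_iff hne, sub_mul, div_mul_cancel₀ _ hne]
      linarith
    have hF' : RegVarTail (fun x => P.real {ω | x < |(-Y ω)|}) α := by simpa only [abs_neg] using hF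
    have := tendsto_pow_mul_measureReal_of_pos (Y := fun ω => -Y ω) hF' hd hbal' (neg_pos.2 hs) hv
    simpa only [tailWeight, normConst, abs_neg, neg_mul_neg, max_eq_right hs.le, h0, mul_zero,
      zero_add, max_eq_left (neg_nonneg.2 hs.le)] using this
  · have : ∀ n, ¬ normConst P d Y n * v < 0 := fun n =>
      (mul_nonneg (tailQuantile_nonneg _ _ _) hv.le).not_gt
    simp [tailWeight, h0, this]
  · have := tendsto_pow_mul_measureReal_of_pos hF hd hbal hs hv
    simpa only [tailWeight, max_eq_left hs.le, max_eq_right (neg_nonpos.2 hs.le), h0, mul_zero,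
      add_zero] using this

/-- Potter's bound made uniform in `j`: the summable majorant behind finiteness of the suprema,
truncation and dominated convergence. -/
theorem measureReal_lt_abs_mul_le {α β : ℝ} {ι : Type*} {c : ι → ℝ} (hβ : 0 < β) (hβα : β < α)
    (hF : RegVarTail (fun x => P.real {ω | x < |Y ω|}) α) (hc : BddAbove (Set.range fun j => |c j|)) :
    ∃ K : ℝ, 0 ≤ K ∧ ∃ x₀ : ℝ, 0 < x₀ ∧ ∀ x, x₀ ≤ x → ∀ j,
      P.real {ω | x < |c j * Y ω|} ≤ K * |c j| ^ β * P.real {ω | x < |Y ω|} := by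
  obtain ⟨C, hC⟩ := hc
  obtain ⟨K, hK, x₀, hx₀, h⟩ := hF.div_le_rpow hβ hβα (C := max C 1) (by positivity)
  refine ⟨K, hK, x₀, hx₀, fun x hx j => ?_⟩
  rcases eq_or_ne (c j) 0 with h0 | h0
  · have : ¬ x < 0 := (hx₀.trans_le hx).le.not_gt
    simp only [h0, zero_mul, abs_zero, this, Set.ofPred_false, measureReal_empty]
    positivity
  · have hpos := abs_pos.2 h0
    convert h x hx |c j| hpos ((hC ⟨j, rfl⟩).trans (le_max_left _ _)) using 3
    ext ω
    rw [abs_mul, div_lt_iff₀ hpos, mul_comm]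

end Tails

/-! ### Extremal coefficients and sums -/

section Coefficients

variable {d : ℕ} {c : (Fin d → ℤ) → ℝ} {α β : ℝ}

theorem tendsto_abs_cofinite (hβ : 0 < β) (hc : Summable fun j => |c j| ^ β) :
    Tendsto (fun j => |c j|) cofinite (𝓝 0) := by
  have h := hc.tendsto_cofinite_zero.rpow_const (p := β⁻¹) (Or.inr (inv_pos.2 hβ).le)
  rw [Real.zero_rpow (inv_pos.2 hβ).ne'] at h
  exact h.congr fun j => Real.rpow_rpow_inv (abs_nonneg _) hβ.ne'

/-- Only finitely many values exceed a given positive one. Attainment matters: the upper bound on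
the maxima needs actual indices realising `c⁺` and `c⁻`. -/
theorem exists_forall_le_of_tendsto_zero {f : (Fin d → ℤ) → ℝ} (hf : ∀ j, 0 ≤ f j)
    (h : Tendsto f cofinite (𝓝 0)) : ∃ j, ∀ i, f i ≤ f j := by
  by_cases h0 : ∃ j, 0 < f j
  · obtain ⟨j, hj⟩ := h0
    refine continuous_of_discreteTopology.exists_forall_ge' j ?_
    rw [cocompact_eq_cofinite]
    exact (h.eventually_lt_const hj).mono fun _ => le_of_lt
  · push Not at h0
    exact ⟨0, fun i => (h0 i).trans (hf 0)⟩

theorem exists_cPlus_eq (hc : Tendsto (fun j => |c j|) cofinite (𝓝 0)) :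
    ∃ j, cPlus c = max (c j) 0 ∧ ∀ i, c i ≤ cPlus c := by
  obtain ⟨j, hj⟩ := exists_forall_le_of_tendsto_zero (f := fun j => max (c j) 0)
    (fun j => le_max_right _ _)
    (squeeze_zero (fun j => le_max_right _ _) (fun j => max_le (le_abs_self _) (abs_nonneg _)) hc)
  have h1 : cPlus c = max (c j) 0 :=
    le_antisymm (ciSup_le hj) (le_ciSup (f := fun j => max (c j) 0) ⟨_, Set.forall_mem_range.2 hj⟩ j)
  exact ⟨j, h1, fun i => h1 ▸ (le_max_left _ _).trans (hj i)⟩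

theorem exists_cMinus_eq (hc : Tendsto (fun j => |c j|) cofinite (𝓝 0)) :
    ∃ j, cMinus c = max (-c j) 0 ∧ ∀ i, -c i ≤ cMinus c :=
  exists_cPlus_eq (c := fun j => -c j) (by simpa only [abs_neg] using hc)

theorem bddAbove_range_abs (hc : Tendsto (fun j => |c j|) cofinite (𝓝 0)) :
    BddAbove (Set.range fun j => |c j|) := by
  obtain ⟨j, hj⟩ := exists_forall_le_of_tendsto_zero (fun j => abs_nonneg _) hc
  exact ⟨_, Set.forall_mem_range.2 hj⟩

theorem summable_abs_rpow (hβ : 0 < β) (hβα : β < α) (hc : Summable fun j => |c j| ^ β) :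
    Summable fun j => |c j| ^ α := by
  refine hc.of_norm_bounded_eventually ?_
  filter_upwards [(tendsto_abs_cofinite hβ hc).eventually_lt_const one_pos] with j hj
  rw [Real.norm_of_nonneg (by positivity)]
  rcases (abs_nonneg (c j)).eq_or_lt with h0 | h0
  · rw [← h0, Real.zero_rpow hβ.ne', Real.zero_rpow (hβ.trans hβα).ne']
  · exact Real.rpow_le_rpow_of_exponent_ge h0 hj.le hβα.le

theorem tsum_subtype_pos_rpow (hα : 0 < α) :
    ∑' j : {j // 0 < c j}, c j ^ α = ∑' j, max (c j) 0 ^ α := by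
  refine (tsum_subtype {j | 0 < c j} fun j => c j ^ α).trans (tsum_congr fun j => ?_)
  by_cases h : 0 < c j
  · rw [Set.indicator_of_mem (by exact h), max_eq_left h.le]
  · rw [Set.indicator_of_notMem (by exact h), max_eq_right (not_lt.1 h), Real.zero_rpow hα.ne']

theorem tsum_subtype_neg_rpow (hα : 0 < α) :
    ∑' j : {j // c j < 0}, |c j| ^ α = ∑' j, max (-c j) 0 ^ α := by
  refine (tsum_subtype {j | c j < 0} fun j => |c j| ^ α).trans (tsum_congr fun j => ?_)
  by_cases h : c j < 0
  · rw [Set.indicator_of_mem (by exact h), max_eq_left (neg_nonneg.2 h.le), abs_of_neg h]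
  · rw [Set.indicator_of_notMem (by exact h), max_eq_right (neg_nonpos.2 (not_lt.1 h)),
      Real.zero_rpow hα.ne']

theorem summable_max_rpow (hα : 0 < α) (hc : Summable fun j => |c j| ^ α) :
    Summable fun j => max (c j) 0 ^ α :=
  hc.of_nonneg_of_le (fun j => by positivity) fun j =>
    Real.rpow_le_rpow (le_max_right _ _) (max_le (le_abs_self _) (abs_nonneg _)) hα.le

theorem summable_max_neg_rpow (hα : 0 < α) (hc : Summable fun j => |c j| ^ α) :
    Summable fun j => max (-c j) 0 ^ α :=
  summable_max_rpow (c := fun j => -c j) hα (by simpa only [abs_neg] using hc)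

theorem tsum_tailWeight (hα : 0 < α) (hc : Summable fun j => |c j| ^ α) (p : ℝ) :
    ∑' j, tailWeight p α (c j) = p * (∑' j : {j // 0 < c j}, c j ^ α)
      + (1 - p) * (∑' j : {j // c j < 0}, |c j| ^ α) := by
  rw [tsum_subtype_pos_rpow hα, tsum_subtype_neg_rpow hα, ← tsum_mul_left, ← tsum_mul_left]
  exact ((summable_max_rpow hα hc).mul_left _).tsum_add ((summable_max_neg_rpow hα hc).mul_left _)

/-- Each maximum is a single term of the corresponding sum; this gives `θ ≤ 1`. -/
theorem cPlus_cMinus_weight_le {p : ℝ} (hp : p ∈ Set.Icc (0 : ℝ) 1) (hα : 0 < α)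
    (h0 : Tendsto (fun j => |c j|) cofinite (𝓝 0)) (hc : Summable fun j => |c j| ^ α) :
    p * cPlus c ^ α + (1 - p) * cMinus c ^ α ≤ p * (∑' j : {j // 0 < c j}, c j ^ α)
      + (1 - p) * (∑' j : {j // c j < 0}, |c j| ^ α) := by
  obtain ⟨j, hj, -⟩ := exists_cPlus_eq h0
  obtain ⟨k, hk, -⟩ := exists_cMinus_eq h0
  rw [tsum_subtype_pos_rpow hα, tsum_subtype_neg_rpow hα, hj, hk]
  have h1 := hp.1
  have h2 := sub_nonneg.2 hp.2
  have h3 := (summable_max_rpow hα hc).le_tsum j fun i _ => by positivity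
  have h4 := (summable_max_neg_rpow hα hc).le_tsum k fun i _ => by positivity
  gcongr

end Coefficients

/-! ### Pathwise comparison with the innovations -/

section Pathwise

variable {d : ℕ} {Ω : Type*} {Z : (Fin d → ℤ) → Ω → ℝ} {c : (Fin d → ℤ) → ℝ}

/-- The sign of `z` decides which extreme coefficient dominates. -/
theorem coeff_mul_le_of_le {a b s z u : ℝ} (hs : s ≤ a) (hs' : -s ≤ b) (h1 : a * z ≤ u)
    (h2 : -b * z ≤ u) : s * z ≤ u := by
  rcases le_total 0 z with h | h
  · exact (mul_le_mul_of_nonneg_right hs h).trans h1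
  · exact (mul_le_mul_of_nonpos_right (by linarith) h).trans h2

theorem max_mul_le_of_le {s z u : ℝ} (hu : 0 ≤ u) (h : s * z ≤ u) : max s 0 * z ≤ u := by
  rcases max_choice s 0 with h' | h' <;> rw [h']
  · exact h
  · simpa using hu

theorem card_Icc_one_sub_add (N : Fin d → ℕ) (r : ℤ) :
    (Finset.Icc (fun _ => 1 - r : Fin d → ℤ) (fun l => (N l : ℤ) + r)).card =
      ∏ l, ((N l : ℤ) + 2 * r).toNat := by
  rw [Pi.card_Icc]
  refine Finset.prod_congr rfl fun l _ => ?_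
  rw [Int.card_Icc]
  congr 1
  ring

theorem le_of_partialMax_movingMax_le {N : Fin d → ℕ} {u : ℝ} {ω : Ω}
    (hbdd : ∀ n : Fin d → ℤ, BddAbove (Set.range fun j => c j * Z (n + j) ω))
    (h : partialMax (movingMax c Z) N ω ≤ u) {i : Fin d → ℤ}
    (hi : i ∈ Set.Icc (1 : Fin d → ℤ) (fun l => (N l : ℤ))) (j : Fin d → ℤ) :
    c j * Z (i + j) ω ≤ u :=
  calc c j * Z (i + j) ω ≤ movingMax c Z i ω := le_ciSup (hbdd i) j
    _ ≤ partialMax (movingMax c Z) N ω :=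
      le_ciSup (f := fun k : Set.Icc (1 : Fin d → ℤ) (fun l => (N l : ℤ)) => movingMax c Z k ω)
        (Set.finite_range _).bddAbove ⟨i, hi⟩
    _ ≤ u := h

/-- With `u ≥ 0` no boundedness is needed, since the default value of a real supremum is `0`. -/
theorem partialMax_movingMax_le {N : Fin d → ℕ} {u : ℝ} {ω : Ω} (hu : 0 ≤ u)
    (h : ∀ i ∈ Set.Icc (1 : Fin d → ℤ) (fun l => (N l : ℤ)), ∀ j, c j * Z (i + j) ω ≤ u) :
    partialMax (movingMax c Z) N ω ≤ u :=
  Real.iSup_le (fun i => Real.iSup_le (h i i.2) hu) hu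

end Pathwise

/-! ### Probability bounds at a fixed level -/

section Field

variable {d : ℕ} {Ω : Type*} [MeasurableSpace Ω] {P : Measure Ω}
  {Z : (Fin d → ℤ) → Ω → ℝ} {c : (Fin d → ℤ) → ℝ} {α β : ℝ}

theorem measurableSet_mul_le_and_mul_le (a b u : ℝ) :
    MeasurableSet {z : ℝ | a * z ≤ u ∧ b * z ≤ u} := by
  have h : ∀ a : ℝ, MeasurableSet {z : ℝ | a * z ≤ u} := fun a =>
    measurableSet_le (measurable_const.mul measurable_id) measurable_const
  exact (h a).inter (h b)

theorem measureReal_forall_mem_eq_pow (hZindep : iIndepFun Z P)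
    (hZident : ∀ j, IdentDistrib (Z j) (Z 0) P P) (S : Finset (Fin d → ℤ)) {B : Set ℝ}
    (hB : MeasurableSet B) :
    P.real {ω | ∀ k ∈ S, Z k ω ∈ B} = P.real {ω | Z 0 ω ∈ B} ^ S.card := by
  have h := hZindep.measure_inter_preimage_eq_mul S (sets := fun _ => B) fun _ _ => hB
  have hset : (⋂ k ∈ S, Z k ⁻¹' B) = {ω | ∀ k ∈ S, Z k ω ∈ B} := by
    ext ω
    simp
  rw [hset, Finset.prod_congr rfl fun k _ => (hZident k).measure_mem_eq hB,
    Finset.prod_const] at h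
  rw [measureReal_def, h, ENNReal.toReal_pow]
  rfl

theorem measureReal_shift_eq (hZident : ∀ j, IdentDistrib (Z j) (Z 0) P P) (k : Fin d → ℤ)
    (s u : ℝ) : P.real {ω | u < s * Z k ω} = P.real {ω | u < s * Z 0 ω} :=
  congrArg ENNReal.toReal ((hZident k).measure_mem_eq (s := {z | u < s * z})
    (measurableSet_lt measurable_const (measurable_const.mul measurable_id)))

variable [IsProbabilityMeasure P]

/-- The two exceedances require opposite signs of `Y`, so their probabilities add exactly. -/
theorem measureReal_mul_le_and_le {Y : Ω → ℝ} (hY : Measurable Y) {a b u : ℝ} (ha : 0 ≤ a)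
    (hb : 0 ≤ b) (hu : 0 ≤ u) :
    P.real {ω | a * Y ω ≤ u ∧ -b * Y ω ≤ u} =
      1 - (P.real {ω | u < a * Y ω} + P.real {ω | u < -b * Y ω}) := by
  have hm : MeasurableSet {ω | u < -b * Y ω} := measurableSet_lt measurable_const (hY.const_mul _)
  have hdisj : Disjoint {ω | u < a * Y ω} {ω | u < -b * Y ω} :=
    Set.disjoint_left.2 fun ω h1 h2 => by
      simp only [Set.mem_ofPred_eq] at h1 h2
      rcases le_total 0 (Y ω) with h | h
      · nlinarith [mul_nonneg hb h]
      · nlinarith [mul_nonneg ha (neg_nonneg.2 h)]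
  rw [← measureReal_union hdisj hm, ← probReal_compl_eq_one_sub
    ((measurableSet_lt measurable_const (hY.const_mul _)).union hm)]
  congr 1
  ext ω
  simp

/-- Borel–Cantelli at one fixed level `x₀`: almost surely only finitely many terms exceed it. -/
theorem ae_bddAbove_range (hZident : ∀ j, IdentDistrib (Z j) (Z 0) P P) (hβ : 0 < β)
    (hβα : β < α) (hF : RegVarTail (fun x => P.real {ω | x < |Z 0 ω|}) α)
    (hc : Summable fun j => |c j| ^ β) :
    ∀ᵐ ω ∂P, ∀ n : Fin d → ℤ, BddAbove (Set.range fun j => c j * Z (n + j) ω) := by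
  obtain ⟨K, hK, x₀, hx₀, h⟩ := measureReal_lt_abs_mul_le hβ hβα hF
    (bddAbove_range_abs (tendsto_abs_cofinite hβ hc))
  refine ae_all_iff.2 fun n => ?_
  have hs : Summable fun j => P.real {ω | x₀ < c j * Z (n + j) ω} := by
    refine (hc.mul_left K).of_nonneg_of_le (fun j => measureReal_nonneg) fun j => ?_
    calc P.real {ω | x₀ < c j * Z (n + j) ω} = P.real {ω | x₀ < c j * Z 0 ω} :=
          measureReal_shift_eq hZident _ _ _
      _ ≤ P.real {ω | x₀ < |c j * Z 0 ω|} :=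
          measureReal_mono fun ω (hω : x₀ < c j * Z 0 ω) => hω.trans_le (le_abs_self _)
      _ ≤ K * |c j| ^ β * P.real {ω | x₀ < |Z 0 ω|} := h x₀ le_rfl j
      _ ≤ K * |c j| ^ β := mul_le_of_le_one_right (by positivity) measureReal_le_one
  have hs' : ∑' j, P {ω | x₀ < c j * Z (n + j) ω} ≠ ⊤ := by
    have := hs.tsum_ofReal_ne_top
    simpa using this
  filter_upwards [ae_finite_setOfPred_mem hs'] with ω hω
  refine ((hω.image fun j => c j * Z (n + j) ω).bddAbove.union (bddAbove_Iic (a := x₀))).mono ?_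
  rintro _ ⟨j, rfl⟩
  by_cases hj : x₀ < c j * Z (n + j) ω
  · exact Or.inl ⟨j, hj, rfl⟩
  · exact Or.inr (not_lt.1 hj)

/-- For `k` in the box shrunk by `r`, both `k - jp` and `k - jm` lie in the original box, so `Z k`
faces both extreme constraints. -/
theorem measureReal_partialMax_le (hZmeas : ∀ j, Measurable (Z j)) (hZindep : iIndepFun Z P)
    (hZident : ∀ j, IdentDistrib (Z j) (Z 0) P P)
    (hbdd : ∀ᵐ ω ∂P, ∀ n : Fin d → ℤ, BddAbove (Set.range fun j => c j * Z (n + j) ω))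
    {jp jm : Fin d → ℤ} {r : ℤ} (hjp : ∀ l, |jp l| ≤ r) (hjm : ∀ l, |jm l| ≤ r)
    (N : Fin d → ℕ) {u : ℝ} (hu : 0 ≤ u) :
    P.real {ω | partialMax (movingMax c Z) N ω ≤ u} ≤
      (1 - (P.real {ω | u < max (c jp) 0 * Z 0 ω} + P.real {ω | u < -max (-c jm) 0 * Z 0 ω})) ^
        ∏ l, ((N l : ℤ) + 2 * -r).toNat := by
  have hB := measurableSet_mul_le_and_mul_le (max (c jp) 0) (-max (-c jm) 0) u
  rw [← measureReal_mul_le_and_le (hZmeas 0) (le_max_right _ _) (le_max_right _ _) hu,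
    ← card_Icc_one_sub_add]
  refine le_trans ?_ (measureReal_forall_mem_eq_pow hZindep hZident _ hB).le
  refine ENNReal.toReal_mono (measure_ne_top _ _) (measure_mono_ae ?_)
  filter_upwards [hbdd] with ω hω hM k hk
  rw [Finset.mem_Icc] at hk
  have key : ∀ j : Fin d → ℤ, (∀ l, |j l| ≤ r) → c j * Z k ω ≤ u := fun j hj => by
    have hi : k - j ∈ Set.Icc (1 : Fin d → ℤ) (fun l => (N l : ℤ)) := by
      refine ⟨fun l => ?_, fun l => ?_⟩
      · have h1 := hk.1 l
        have h2 := abs_le.1 (hj l)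
        simp only [Pi.one_apply, Pi.sub_apply] at h1 ⊢
        linarith
      · have h1 := hk.2 l
        have h2 := abs_le.1 (hj l)
        simp only [Pi.sub_apply] at h1 ⊢
        linarith
    simpa using le_of_partialMax_movingMax_le hω hM hi j
  refine ⟨max_mul_le_of_le hu (key jp hjp), ?_⟩
  have := max_mul_le_of_le (s := -c jm) (z := -Z k ω) hu (by simpa using key jm hjm)
  rwa [mul_neg, ← neg_mul] at this

/-- If the extreme constraints hold on the box enlarged by `r`, only an index `j` outside the cube
can cause an exceedance; the subtracted term is the union bound for these. -/
theorem le_measureReal_partialMax (hZmeas : ∀ j, Measurable (Z j)) (hZindep : iIndepFun Z P)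
    (hZident : ∀ j, IdentDistrib (Z j) (Z 0) P P) {a b : ℝ} (ha : 0 ≤ a) (hb : 0 ≤ b)
    (hca : ∀ j, c j ≤ a) (hcb : ∀ j, -c j ≤ b) (r : ℤ) (N : Fin d → ℕ) {u : ℝ} (hu : 0 ≤ u)
    (hs : Summable fun j => P.real {ω | u < c j * Z 0 ω}) :
    (1 - (P.real {ω | u < a * Z 0 ω} + P.real {ω | u < -b * Z 0 ω})) ^
        (∏ l, ((N l : ℤ) + 2 * r).toNat) -
      (∏ l, (N l : ℝ)) * (∑' j : {j // j ∉ Finset.Icc (fun _ => -r : Fin d → ℤ) fun _ => r},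
        P.real {ω | u < c j * Z 0 ω}) ≤
      P.real {ω | partialMax (movingMax c Z) N ω ≤ u} := by
  set J := Finset.Icc (fun _ => -r : Fin d → ℤ) fun _ => r with hJ
  set S := Finset.Icc (1 : Fin d → ℤ) fun l => (N l : ℤ) with hS
  set T := ∑' j : {j // j ∉ J}, P.real {ω | u < c j * Z 0 ω} with hT
  have hB := measurableSet_mul_le_and_mul_le a (-b) u
  have hcard : (S.card : ℝ) = ∏ l, (N l : ℝ) := by
    have := card_Icc_one_sub_add N 0
    simp only [sub_zero, add_zero, mul_zero, Int.toNat_natCast] at this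
    rw [← Nat.cast_prod, ← this]
    rfl
  have hU : P.real (⋃ i ∈ S, ⋃ j : {j // j ∉ J}, {ω | u < c j * Z (i + j) ω}) ≤
      (∏ l, (N l : ℝ)) * T := by
    refine (measureReal_biUnion_finset_le _ _).trans ?_
    rw [← hcard, ← nsmul_eq_mul]
    refine Finset.sum_le_card_nsmul _ _ _ fun i _ => ?_
    have hsh : ∀ j : {j // j ∉ J}, P.real {ω | u < c j * Z (i + j) ω}
        = P.real {ω | u < c j * Z 0 ω} := fun j => measureReal_shift_eq hZident _ _ _
    refine (measureReal_iUnion_le_tsum _ ?_).trans (tsum_congr hsh).le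
    simp only [hsh]
    exact hs.subtype _
  rw [← measureReal_mul_le_and_le (hZmeas 0) ha hb hu, ← card_Icc_one_sub_add, sub_le_iff_le_add]
  refine (measureReal_forall_mem_eq_pow hZindep hZident _ hB).ge.trans ?_
  refine le_trans ?_ (add_le_add_right hU _)
  refine le_trans (measureReal_mono ?_) (measureReal_union_le _ _)
  intro ω hω
  by_cases hM : partialMax (movingMax c Z) N ω ≤ u
  · exact Or.inl hM
  right
  by_contra hcon
  simp only [Set.mem_iUnion, not_exists] at hcon
  refine hM (partialMax_movingMax_le hu fun i hi j => ?_)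
  by_cases hj : j ∈ J
  · have hk := hω (i + j) (by
      rw [hJ, Finset.mem_Icc] at hj
      refine Finset.mem_Icc.2 ⟨fun l => ?_, fun l => ?_⟩
      · have h1 := hi.1 l
        have h2 := hj.1 l
        simp only [Pi.one_apply, Pi.add_apply] at *
        linarith
      · have h1 := hi.2 l
        have h2 := hj.2 l
        simp only [Pi.add_apply] at *
        linarith)
    exact coeff_mul_le_of_le (hca j) (hcb j) hk.1 hk.2
  · exact not_lt.1 (hcon i (Finset.mem_Icc.2 hi) ⟨j, hj⟩)

theorem one_sub_tsum_le_measureReal_movingMax (hZident : ∀ j, IdentDistrib (Z j) (Z 0) P P)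
    {u : ℝ} (hu : 0 ≤ u) (hs : Summable fun j => P.real {ω | u < c j * Z 0 ω}) :
    1 - ∑' j, P.real {ω | u < c j * Z 0 ω} ≤ P.real {ω | movingMax c Z 0 ω ≤ u} := by
  have hsh : ∀ j, P.real {ω | u < c j * Z (0 + j) ω} = P.real {ω | u < c j * Z 0 ω} :=
    fun j => measureReal_shift_eq hZident _ _ _
  have hU := measureReal_iUnion_le_tsum (P := P) (fun j => {ω | u < c j * Z (0 + j) ω})
    (by simpa only [hsh] using hs)
  simp only [hsh] at hU
  rw [sub_le_iff_le_add]
  refine le_trans ?_ (add_le_add_right hU _)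
  refine le_trans ?_ (measureReal_union_le _ _)
  rw [← probReal_univ (μ := P)]
  refine measureReal_mono fun ω _ => ?_
  by_contra hcon
  simp only [Set.mem_union, Set.mem_iUnion, not_or, not_exists] at hcon
  exact hcon.1 (Real.iSup_le (fun j => not_lt.1 (hcon.2 j)) hu)

/-- Independence over a finite set of indices and `1 - x ≤ exp (-x)`, then a limit along finite
sets. -/
theorem measureReal_movingMax_le_exp (hZmeas : ∀ j, Measurable (Z j)) (hZindep : iIndepFun Z P)
    (hZident : ∀ j, IdentDistrib (Z j) (Z 0) P P)
    (hbdd : ∀ᵐ ω ∂P, ∀ n : Fin d → ℤ, BddAbove (Set.range fun j => c j * Z (n + j) ω))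
    {u : ℝ} (hs : Summable fun j => P.real {ω | u < c j * Z 0 ω}) :
    P.real {ω | movingMax c Z 0 ω ≤ u} ≤
      Real.exp (-∑' j, P.real {ω | u < c j * Z 0 ω}) := by
  refine ge_of_tendsto ((Real.continuous_exp.tendsto _).comp hs.hasSum.neg)
    (Eventually.of_forall fun S => ?_)
  have hm : ∀ j, MeasurableSet {z : ℝ | c j * z ≤ u} := fun j =>
    measurableSet_le (by fun_prop) measurable_const
  have hprod := hZindep.measure_inter_preimage_eq_mul S (sets := fun j => {z | c j * z ≤ u})
    fun j _ => hm j
  have hle : P.real {ω | movingMax c Z 0 ω ≤ u} ≤ P.real (⋂ j ∈ S, Z j ⁻¹' {z | c j * z ≤ u}) := by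
    refine ENNReal.toReal_mono (measure_ne_top _ _) (measure_mono_ae ?_)
    filter_upwards [hbdd] with ω hω hM
    refine Set.mem_iInter₂.2 fun j _ => ?_
    have := (le_ciSup (hω 0) j).trans hM
    simpa using this
  refine hle.trans ?_
  rw [measureReal_def, hprod, ENNReal.toReal_prod]
  simp only [Function.comp_apply]
  rw [Real.exp_sum]
  refine Finset.prod_le_prod (fun j _ => ENNReal.toReal_nonneg) fun j _ => ?_
  refine le_trans (le_of_eq ?_) (Real.one_sub_le_exp_neg _)
  rw [← measureReal_shift_eq hZident j, ← probReal_compl_eq_one_sub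
    (measurableSet_lt measurable_const ((hZmeas j).const_mul _))]
  congr 2
  ext ω
  simp

end Field

/-! ### Passage to the limit -/

theorem exists_tsum_compl_cube_lt {d : ℕ} {f : (Fin d → ℤ) → ℝ} {ε : ℝ} (hε : 0 < ε) :
    ∃ r : ℕ, ∑' j : {j // j ∉ Finset.Icc (fun _ => -(r : ℤ) : Fin d → ℤ) fun _ => (r : ℤ)},
      f j < ε := by
  have h : Tendsto (fun r : ℕ => Finset.Icc (fun _ => -(r : ℤ) : Fin d → ℤ) fun _ => (r : ℤ))
      atTop atTop := by
    refine tendsto_atTop_finset_of_monotone (fun r s hrs => ?_) fun j => ?_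
    · refine Finset.Icc_subset_Icc (fun _ => ?_) fun _ => ?_ <;> simpa using hrs
    · refine ⟨∑ l, (j l).natAbs, Finset.mem_Icc.2 ⟨fun l => ?_, fun l => ?_⟩⟩ <;>
      · have := Finset.single_le_sum (f := fun l => (j l).natAbs) (fun _ _ => Nat.zero_le _)
          (Finset.mem_univ l)
        simp only at this ⊢
        omega
  exact (((tendsto_tsum_compl_atTop_zero f).comp h).eventually_lt_const hε).exists

section Limits

variable {d : ℕ} {Ω : Type*} [MeasurableSpace Ω] {P : Measure Ω} [IsProbabilityMeasure P]
  {Z : (Fin d → ℤ) → Ω → ℝ} {c : (Fin d → ℤ) → ℝ} {α β p v : ℝ}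

theorem eventually_measureReal_le_rpow (hd : 1 ≤ d) (hβ : 0 < β) (hβα : β < α)
    (hF : RegVarTail (fun x => P.real {ω | x < |Z 0 ω|}) α) (hv : 0 < v)
    (hc : Summable fun j => |c j| ^ β) :
    ∃ K : ℝ, 0 ≤ K ∧ ∀ᶠ n : ℕ in atTop, ∀ j,
      P.real {ω | normConst P d (Z 0) n * v < c j * Z 0 ω} ≤
        K * |c j| ^ β * P.real {ω | normConst P d (Z 0) n * v < |Z 0 ω|} := by
  obtain ⟨K, hK, x₀, hx₀, h⟩ := measureReal_lt_abs_mul_le hβ hβα hF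
    (bddAbove_range_abs (tendsto_abs_cofinite hβ hc))
  refine ⟨K, hK, ?_⟩
  have ha : Tendsto (fun n => normConst P d (Z 0) n * v) atTop atTop :=
    (hF.tendsto_tailQuantile hd).atTop_mul_const hv
  filter_upwards [ha.eventually_ge_atTop x₀] with n hn j
  exact le_trans (measureReal_mono fun ω
    (hω : normConst P d (Z 0) n * v < c j * Z 0 ω) => hω.trans_le (le_abs_self _)) (h _ hn j)

theorem tendsto_measureReal_partialMax (hd : 1 ≤ d) (hZmeas : ∀ j, Measurable (Z j))
    (hZindep : iIndepFun Z P) (hZident : ∀ j, IdentDistrib (Z j) (Z 0) P P) (hα : 0 < α)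
    (hF : RegVarTail (fun x => P.real {ω | x < |Z 0 ω|}) α)
    (hbal : Tendsto (fun x : ℝ => P.real {ω | x < Z 0 ω} / P.real {ω | x < |Z 0 ω|})
      atTop (𝓝 p)) (hβ : 0 < β) (hβα : β < α) (hc : Summable fun j => |c j| ^ β)
    {N : ℕ → Fin d → ℕ} (hN : ∀ l, Tendsto (fun n => N n l) atTop atTop)
    (hNd : (fun n : ℕ => ∏ l, (N n l : ℝ)) ~[atTop] fun n : ℕ => (n : ℝ) ^ d) (hv : 0 < v) :
    Tendsto (fun n : ℕ => P.real {ω |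
      partialMax (movingMax c Z) (N n) ω ≤ normConst P d (Z 0) n * v}) atTop
      (𝓝 (Real.exp (-((p * cPlus c ^ α + (1 - p) * cMinus c ^ α) * v ^ (-α))))) := by
  have hc0 := tendsto_abs_cofinite hβ hc
  obtain ⟨jp, hjp, hcp⟩ := exists_cPlus_eq hc0
  obtain ⟨jm, hjm, hcm⟩ := exists_cMinus_eq hc0
  have hcp0 : 0 ≤ cPlus c := hjp ▸ le_max_right _ _
  have hcm0 : 0 ≤ cMinus c := hjm ▸ le_max_right _ _
  set u : ℕ → ℝ := fun n => normConst P d (Z 0) n * v with hu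
  have hu0 : ∀ n, 0 ≤ u n := fun n => mul_nonneg (tailQuantile_nonneg _ _ _) hv.le
  have hQ : Tendsto (fun n : ℕ => (n : ℝ) ^ d * (P.real {ω | u n < cPlus c * Z 0 ω} +
      P.real {ω | u n < -cMinus c * Z 0 ω})) atTop
      (𝓝 ((p * cPlus c ^ α + (1 - p) * cMinus c ^ α) * v ^ (-α))) := by
    have h1 := tendsto_pow_mul_measureReal (hZmeas 0) hα hF hd hbal (cPlus c) hv
    have h2 := tendsto_pow_mul_measureReal (hZmeas 0) hα hF hd hbal (-cMinus c) hv
    have h0 : (0 : ℝ) ^ α = 0 := Real.zero_rpow hα.ne'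
    have h3 := h1.add h2
    simp only [tailWeight, max_eq_left hcp0, max_eq_right (neg_nonpos.2 hcp0),
      max_eq_right (neg_nonpos.2 hcm0), neg_neg, max_eq_left hcm0, h0, mul_zero, add_zero,
      zero_add, ← add_mul] at h3
    exact h3.congr fun n => (mul_add _ _ _).symm
  refine tendsto_order.2 ⟨fun b hb => ?_, fun b hb => ?_⟩
  · obtain ⟨K, hK, hKle⟩ := eventually_measureReal_le_rpow hd hβ hβα hF hv hc
    have hvα := Real.rpow_pos_of_pos hv (-α)
    -- The limiting truncation error `v ^ (-α) * K * ρ` has to fit into the gap above `b`; `K + 1`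
    -- replaces `K` to avoid division by zero.
    obtain ⟨r, hr⟩ := exists_tsum_compl_cube_lt (f := fun j => |c j| ^ β)
      (div_pos (sub_pos.2 hb) (by positivity : 0 < v ^ (-α) * (K + 1)))
    set J := Finset.Icc (fun _ => -(r : ℤ) : Fin d → ℤ) fun _ => (r : ℤ)
    set ρ := ∑' j : {j // j ∉ J}, |c j| ^ β
    have hρ : 0 ≤ ρ := tsum_nonneg fun _ => by positivity
    have hE : v ^ (-α) * K * ρ
        < Real.exp (-((p * cPlus c ^ α + (1 - p) * cMinus c ^ α) * v ^ (-α))) - b := by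
      rw [lt_div_iff₀ (by positivity)] at hr
      refine lt_of_le_of_lt ?_ hr
      have := mul_nonneg hρ hvα.le
      nlinarith
    have hbox : Tendsto (fun n => (∏ l, (N n l : ℝ)) * P.real {ω | u n < |Z 0 ω|}) atTop
        (𝓝 (v ^ (-α))) := by
      have h1 := (tendsto_prod_toNat_div hN hNd 0).mul (hF.tendsto_pow_mul hd hv)
      simp only [add_zero, Int.toNat_natCast, one_mul] at h1
      refine h1.congr' ?_
      filter_upwards [eventually_gt_atTop 0] with n hn
      have : (n : ℝ) ^ d ≠ 0 := by positivity
      field_simp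
      rfl
    have hlow := (tendsto_one_sub_pow_prod_toNat hd hN hNd (2 * r) hQ).sub
      ((hbox.mul_const K).mul_const ρ)
    filter_upwards [hlow.eventually_const_lt (by linarith : b < _), hKle] with n hn hle
    have hs : Summable fun j => P.real {ω | u n < c j * Z 0 ω} :=
      ((hc.mul_left K).mul_right _).of_nonneg_of_le (fun _ => measureReal_nonneg) hle
    refine hn.trans_le (le_trans ?_
      (le_measureReal_partialMax hZmeas hZindep hZident hcp0 hcm0 hcp hcm r (N n) (hu0 n) hs))
    refine sub_le_sub_left ?_ _
    have hT : ∑' j : {j // j ∉ J}, P.real {ω | u n < c j * Z 0 ω} ≤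
        P.real {ω | u n < |Z 0 ω|} * K * ρ := by
      rw [← tsum_mul_left]
      refine Summable.tsum_le_tsum (fun j => (hle j).trans_eq (by ring)) (hs.subtype _)
        ((hc.subtype _).mul_left _)
    calc _ ≤ (∏ l, (N n l : ℝ)) * (P.real {ω | u n < |Z 0 ω|} * K * ρ) := by gcongr
      _ = _ := by ring
  · have hr : ∃ r : ℤ, (∀ l, |jp l| ≤ r) ∧ ∀ l, |jm l| ≤ r := by
      refine ⟨∑ l, (|jp l| + |jm l|), fun l => ?_, fun l => ?_⟩ <;>
      · have := Finset.single_le_sum (f := fun l => |jp l| + |jm l|) (fun _ _ => by positivity)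
          (Finset.mem_univ l)
        have h1 := abs_nonneg (jp l)
        have h2 := abs_nonneg (jm l)
        linarith
    obtain ⟨r, hr1, hr2⟩ := hr
    have hbdd := ae_bddAbove_range hZident hβ hβα hF hc
    filter_upwards [(tendsto_one_sub_pow_prod_toNat hd hN hNd (2 * -r) hQ).eventually_lt_const hb]
      with n hn
    refine lt_of_le_of_lt ?_ hn
    rw [hjp, hjm]
    exact measureReal_partialMax_le hZmeas hZindep hZident hbdd hr1 hr2 (N n) (hu0 n)

theorem tendsto_pow_mul_tsum_measureReal (hd : 1 ≤ d) (hZmeas : ∀ j, Measurable (Z j))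
    (hα : 0 < α) (hF : RegVarTail (fun x => P.real {ω | x < |Z 0 ω|}) α)
    (hbal : Tendsto (fun x : ℝ => P.real {ω | x < Z 0 ω} / P.real {ω | x < |Z 0 ω|})
      atTop (𝓝 p)) (hβ : 0 < β) (hβα : β < α) (hc : Summable fun j => |c j| ^ β) (hv : 0 < v) :
    Tendsto (fun n : ℕ => (n : ℝ) ^ d *
      ∑' j, P.real {ω | normConst P d (Z 0) n * v < c j * Z 0 ω}) atTop
      (𝓝 ((∑' j, tailWeight p α (c j)) * v ^ (-α))) := by
  obtain ⟨K, hK, hKle⟩ := eventually_measureReal_le_rpow hd hβ hβα hF hv hc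
  simp only [← tsum_mul_left, ← tsum_mul_right]
  refine tendsto_tsum_of_dominated_convergence (hc.mul_left (K * (v ^ (-α) + 1)))
    (fun j => tendsto_pow_mul_measureReal (hZmeas 0) hα hF hd hbal (c j) hv) ?_
  -- The factor `n^d P(|Z_0| > a_n v)` converges, hence is eventually below `v ^ (-α) + 1`; the
  -- majorant is then free of `n`.
  filter_upwards [hKle, (hF.tendsto_pow_mul hd hv).eventually_lt_const (lt_add_one _)]
    with n hn hn' j
  rw [Real.norm_of_nonneg (by positivity)]
  have hn'' : (n : ℝ) ^ d * P.real {ω | normConst P d (Z 0) n * v < |Z 0 ω|} < v ^ (-α) + 1 := hn'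
  calc _ ≤ (n : ℝ) ^ d *
        (K * |c j| ^ β * P.real {ω | normConst P d (Z 0) n * v < |Z 0 ω|}) := by
        gcongr
        exact hn j
    _ = K * |c j| ^ β * ((n : ℝ) ^ d * P.real {ω | normConst P d (Z 0) n * v < |Z 0 ω|}) := by
        ring
    _ ≤ K * |c j| ^ β * (v ^ (-α) + 1) := by gcongr
    _ = _ := by ring

theorem tendsto_measureReal_movingMax_rpow (hd : 1 ≤ d) (hZmeas : ∀ j, Measurable (Z j))
    (hZindep : iIndepFun Z P) (hZident : ∀ j, IdentDistrib (Z j) (Z 0) P P)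
    (hα : 0 < α) (hF : RegVarTail (fun x => P.real {ω | x < |Z 0 ω|}) α)
    (hbal : Tendsto (fun x : ℝ => P.real {ω | x < Z 0 ω} / P.real {ω | x < |Z 0 ω|})
      atTop (𝓝 p)) (hβ : 0 < β) (hβα : β < α) (hc : Summable fun j => |c j| ^ β) (hv : 0 < v)
    {θ : ℝ} (hθ : 0 ≤ θ) :
    Tendsto (fun n : ℕ => P.real {ω | movingMax c Z 0 ω ≤ normConst P d (Z 0) n * v} ^
      (θ * (n : ℝ) ^ d)) atTop
      (𝓝 (Real.exp (-(θ * ((∑' j, tailWeight p α (c j)) * v ^ (-α)))))) := by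
  have hq := tendsto_pow_mul_tsum_measureReal hd hZmeas hα hF hbal hβ hβα hc hv
  obtain ⟨K, hK, hKle⟩ := eventually_measureReal_le_rpow hd hβ hβα hF hv hc
  have hs : ∀ᶠ n : ℕ in atTop,
      Summable fun j => P.real {ω | normConst P d (Z 0) n * v < c j * Z 0 ω} :=
    hKle.mono fun n hle =>
      ((hc.mul_left K).mul_right _).of_nonneg_of_le (fun _ => measureReal_nonneg) hle
  refine tendsto_rpow_exp_neg (fun n => by positivity) (tendsto_zero_of_pow_mul hd hq)
    ((hq.const_mul θ).congr fun n => (mul_assoc _ _ _).symm) ?_ ?_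
  · filter_upwards [hs] with n hn
    exact one_sub_tsum_le_measureReal_movingMax hZident
      (mul_nonneg (tailQuantile_nonneg _ _ _) hv.le) hn
  · filter_upwards [hs] with n hn
    exact measureReal_movingMax_le_exp hZmeas hZindep hZident
      (ae_bddAbove_range hZident hβ hβα hF hc) hn

end Limits

end MovingMaxima

/-! ### Identification of the extremal index -/

theorem mainTheorem6 {d : ℕ} (hd : 1 ≤ d)
    {Ω : Type*} [MeasurableSpace Ω] (P : Measure Ω) [IsProbabilityMeasure P]
    -- the i.i.d. array `Z`
    (Z : (Fin d → ℤ) → Ω → ℝ) (hZmeas : ∀ j, Measurable (Z j)) (hZindep : iIndepFun Z P)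
    (hZident : ∀ j, IdentDistrib (Z j) (Z 0) P P)
    -- regular variation with index `α` and tail balance
    (α : ℝ) (hα : 0 < α) (L : ℝ → ℝ) (hL : MovingMaxima.SlowlyVarying L)
    (hreg : ∀ x : ℝ, 0 < x → P.real {ω | x < |Z 0 ω|} = x ^ (-α) * L x)
    (p : ℝ) (hp : p ∈ Set.Icc (0 : ℝ) 1)
    (hbal : Tendsto (fun x : ℝ => P.real {ω | x < Z 0 ω} / P.real {ω | x < |Z 0 ω|})
      atTop (𝓝 p))
    -- the coefficients
    (c : (Fin d → ℤ) → ℝ) (hc : ∃ j, c j ≠ 0)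
    (β : ℝ) (hβ : 0 < β) (hβα : β < α) (hcsum : Summable fun j => |c j| ^ β) :
    -- the field is well defined
    (∀ᵐ ω ∂P, ∀ n : Fin d → ℤ, BddAbove (Set.range fun j : Fin d → ℤ => c j * Z (n + j) ω)) ∧
    (Summable fun j => |c j| ^ α) ∧
    ∀ N : ℕ → Fin d → ℕ, (∀ l, Tendsto (fun n => N n l) atTop atTop) →
      ((fun n : ℕ => ∏ l, (N n l : ℝ)) ~[atTop] fun n : ℕ => (n : ℝ) ^ d) →
      ∀ v : ℝ, 0 < v →
        -- limit law of the partial maxima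
        Tendsto (fun n : ℕ => P.real {ω |
            MovingMaxima.partialMax (MovingMaxima.movingMax c Z) (N n) ω
              ≤ MovingMaxima.normConst P d (Z 0) n * v}) atTop
          (𝓝 (Real.exp (-((p * MovingMaxima.cPlus c ^ α + (1 - p) * MovingMaxima.cMinus c ^ α)
            * v ^ (-α))))) ∧
        -- the extremal index exists, is unique, and is given by the formula
        (0 < p * (∑' j : {j // 0 < c j}, c j ^ α) + (1 - p) * (∑' j : {j // c j < 0}, |c j| ^ α) →
          ∀ θ : ℝ, MovingMaxima.IsExtremalIndex P (MovingMaxima.movingMax c Z) N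
              (fun n => MovingMaxima.normConst P d (Z 0) n * v) θ ↔
            θ = (p * MovingMaxima.cPlus c ^ α + (1 - p) * MovingMaxima.cMinus c ^ α) /
              (p * (∑' j : {j // 0 < c j}, c j ^ α)
                + (1 - p) * (∑' j : {j // c j < 0}, |c j| ^ α))) := by
  have hF := MovingMaxima.regVarTail_abs (hZmeas 0) hL hreg
  have hcα := MovingMaxima.summable_abs_rpow hβ hβα hcsum
  refine ⟨MovingMaxima.ae_bddAbove_range hZident hβ hβα hF hcsum, hcα, fun N hN hNd v hv => ?_⟩
  have hM := MovingMaxima.tendsto_measureReal_partialMax hd hZmeas hZindep hZident hα hF hbal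
    hβ hβα hcsum hN hNd hv
  refine ⟨hM, fun hpos θ => ?_⟩
  have hX : ∀ {θ : ℝ}, 0 ≤ θ → _ := fun {θ} =>
    MovingMaxima.tendsto_measureReal_movingMax_rpow (θ := θ) hd hZmeas hZindep hZident hα hF hbal
      hβ hβα hcsum hv
  rw [MovingMaxima.tsum_tailWeight hα hcα] at hX
  have hle := MovingMaxima.cPlus_cMinus_weight_le hp hα
    (MovingMaxima.tendsto_abs_cofinite hβ hcsum) hcα
  set B := p * (∑' j : {j // 0 < c j}, c j ^ α) + (1 - p) * (∑' j : {j // c j < 0}, |c j| ^ α)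
  set A := p * MovingMaxima.cPlus c ^ α + (1 - p) * MovingMaxima.cMinus c ^ α with hA
  have hA0 : 0 ≤ A := by
    have h1 := hp.1
    have h2 := sub_nonneg.2 hp.2
    have h3 : 0 ≤ MovingMaxima.cPlus c := Real.iSup_nonneg fun _ => le_max_right _ _
    have h4 : 0 ≤ MovingMaxima.cMinus c := Real.iSup_nonneg fun _ => le_max_right _ _
    positivity
  have hvα := Real.rpow_pos_of_pos hv (-α)
  constructor
  · rintro ⟨hθ, hlim⟩
    -- Both terms of the difference converge, so an extremal index must equate their exponential
    -- limits; injectivity of `exp` does the rest.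
    have h := tendsto_nhds_unique (hM.sub (hX hθ.1)) hlim
    have h' := neg_injective (Real.exp_injective (sub_eq_zero.1 h))
    rw [eq_div_iff hpos.ne']
    refine mul_right_cancel₀ hvα.ne' ?_
    rw [h', mul_assoc]
  · rintro rfl
    refine ⟨⟨by positivity, div_le_one_of_le₀ hle hpos.le⟩, ?_⟩
    have h := hM.sub (hX (div_nonneg hA0 hpos.le))
    rwa [← mul_assoc, div_mul_cancel₀ _ hpos.ne', sub_self] at h
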